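/- Let $G$ be a Hausdorff ample groupoid, that is, a topological groupoid (a set $G$ with a partially defined composition and an inversion satisfying the groupoid axioms, with a Hausdorff topology making both operations continuous) whose topology has a basis of compact open bisections; here an open bisection is an open set $B\subseteq G$ such that the range map $r(\gamma)=\gamma\gamma^{-1}$ and the source map $s(\gamma)=\gamma^{-1}\gamma$ restrict to homeomorphisms of $B$ onto open sets. Let $G^{(0)}=r(G)=s(G)$ be the unit space. Let $R$ be a commutative ring with identity $1\neq 0$, and let $A_R(G)$ be the Steinberg algebra: the $R$-algebra of locally constant functions $f:G\to R$ with compact support, with pointwise addition and scalar multiplication and with the convolution product $$(f*g)(\alpha)=\sum_{r(\beta)=r(\alpha)} f(\beta)\,g(\beta^{-1}\alpha).$$ Call a two-sided ideal $I$ of $A_R(G)$ basic if, for every nonzero $c\in R$ and every compact open $K\subseteq G^{(0)}$, $c\,1_K\in I$ implies $1_K\in I$, where $1_K$ is the characteristic function of $K$. Call $A_R(G)$ basically simple if its only basic ideals are $\{0\}$ and $A_R(G)$ (these may coincide). Call $G$ effective if the interior of $\{\gamma\in G: s(\gamma)=r(\gamma)\}\setminus G^{(0)}$ is empty, and minimal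 if the only subsets $U\subseteq G^{(0)}$ that are open in $G^{(0)}$ and invariant (that is, $r(s^{-1}(U))=U$) are $\emptyset$ and $G^{(0)}$. Then $A_R(G)$ is basically simple if and only if $G$ is effective and minimal. -/

import Mathlib

namespace Steinberg

open Set Topology

/-- A groupoid, presented as a set of arrows `G` with a set `G⁽²⁾` of composable pairs
(`Comp a b` says that `(a, b) ∈ G⁽²⁾`), a composition and an involution.
`mul` is written as a total function for convenience; its values on pairs that are not composable
are arbitrary, no axiom mentions them and no definition below looks at them. -/
class AlgGroupoid (G : Type*) where
  /-- `(a, b) ∈ G⁽²⁾`. -/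
  Comp : G → G → Prop
  /-- composition; only meaningful on composable pairs -/
  mul : G → G → G
  /-- the involution `a ↦ a⁻¹` -/
  inv : G → G
  inv_invol : ∀ a, inv (inv a) = a
  comp_mul_left : ∀ {a b c}, Comp a b → Comp b c → Comp (mul a b) c
  comp_mul_right : ∀ {a b c}, Comp a b → Comp b c → Comp a (mul b c)
  comp_assoc : ∀ {a b c}, Comp a b → Comp b c → mul (mul a b) c = mul a (mul b c)
  inv_comp : ∀ a, Comp (inv a) a
  cancel_left : ∀ {a b}, Comp a b → mul (inv a) (mul a b) = b
  cancel_right : ∀ {a b}, Comp a b → mul (mul a b) (inv b) = a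

section Algebraic

variable {G : Type*} [AlgGroupoid G]

open AlgGroupoid

/-- The range map `r(a) = a a⁻¹`. -/
def r (a : G) : G := mul a (inv a)

/-- The source map `s(a) = a⁻¹ a`. -/
def s (a : G) : G := mul (inv a) a

variable (G) in
/-- The unit space `G⁽⁰⁾`: the image of `r`, which is also the image of `s`
(see `unitSpace_eq_range_s`). -/
def unitSpace : Set G := range (r : G → G)

variable (G) in
/-- The isotropy subgroupoid `Iso(G)`. -/
def Iso : Set G := {a | s a = r a}

/-- A subset `U` of the unit space is invariant if `r(s⁻¹(U)) = U`. -/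
def IsInvariant (U : Set G) : Prop := r '' (s ⁻¹' U) = U

theorem comp_inv (a : G) : Comp a (inv a) := by
  have := inv_comp (inv a); rwa [inv_invol] at this

theorem s_inv (a : G) : s (inv a) = r a := by simp [s, r, inv_invol]

theorem r_inv (a : G) : r (inv a) = s a := by simp [s, r, inv_invol]

theorem unitSpace_eq_range_s : unitSpace G = range (s : G → G) := by
  ext u; constructor
  · rintro ⟨a, rfl⟩; exact ⟨inv a, s_inv a⟩
  · rintro ⟨a, rfl⟩; exact ⟨inv a, r_inv a⟩

theorem comp_iff {a b : G} : Comp a b ↔ s a = r b := by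
  constructor
  · intro h
    have h1 : mul (mul (inv a) (mul a b)) (inv b) = r b := by
      rw [cancel_left h]; rfl
    have h2 := comp_assoc (comp_mul_right (inv_comp a) h) (comp_mul_left h (comp_inv b))
    rw [← h1, h2, cancel_right h]; rfl
  · intro h
    have h1 : Comp a (s a) := comp_mul_right (comp_inv a) (inv_comp a)
    have h2 : Comp (r b) b := comp_mul_left (comp_inv b) (inv_comp b)
    have h3 : mul (r b) b = b := by
      have := cancel_right (comp_inv b); rwa [inv_invol] at this
    rw [← h3]; exact comp_mul_right (h ▸ h1) h2

theorem inv_comp_of {a b : G} (h : r a = r b) : Comp (inv a) b := by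
  rw [comp_iff, s_inv, h]

theorem r_mul {a b : G} (h : Comp a b) : r (mul a b) = r a := by
  rw [← comp_iff.1 (comp_mul_right (inv_comp a) h), s_inv]

theorem mul_inv_mul {a b : G} (h : r a = r b) : mul a (mul (inv a) b) = b := by
  have := cancel_left (inv_comp_of h); rwa [inv_invol] at this

theorem inv_mul_mul {a b c : G} (h : Comp a b) (h' : r a = r c) :
    mul (inv (mul a b)) c = mul (inv b) (mul (inv a) c) := by
  have hbx : r b = r (mul (inv a) c) := by
    rw [r_mul (inv_comp_of h'), r_inv, comp_iff.1 h]
  have e1 := mul_inv_mul hbx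
  have hb : Comp b (mul (inv b) (mul (inv a) c)) := comp_mul_right (comp_inv b) (inv_comp_of hbx)
  have e2 := comp_assoc h hb
  rw [e1, mul_inv_mul h'] at e2
  rw [← e2, cancel_left (comp_mul_left h hb), e2]

end Algebraic

/-- A topological groupoid: composition (on `G⁽²⁾`, with the topology of `G × G`) and inversion
are continuous. -/
class TopGroupoid (G : Type*) [TopologicalSpace G] extends AlgGroupoid G where
  continuousOn_mul : ContinuousOn (fun p : G × G => mul p.1 p.2) {p | Comp p.1 p.2}
  continuous_inversion : Continuous inv

section Topological

variable {G : Type*} [TopologicalSpace G] [TopGroupoid G]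

/-- An open bisection: an open set `B` such that `r` and `s` restrict to homeomorphisms of `B`
onto open sets. Here `r` and `s` are maps `G → G`; if `G` has a basis of open bisections then
`G⁽⁰⁾` is open in `G`, so that it does not matter whether `r(B)` and `s(B)` are required
to be open in `G` or in `G⁽⁰⁾`. -/
structure IsOpenBisection (B : Set G) : Prop where
  isOpen : IsOpen B
  isOpenEmbedding_r : IsOpenEmbedding (B.domRestrict r)
  isOpenEmbedding_s : IsOpenEmbedding (B.domRestrict s)

end Topological

/-- An ample groupoid: a topological groupoid with a basis of compact open bisections. -/
class AmpleGroupoid (G : Type*) [TopologicalSpace G] extends TopGroupoid G where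
  isTopologicalBasis :
    TopologicalSpace.IsTopologicalBasis {B : Set G | IsCompact B ∧ IsOpenBisection B}

section Topological

variable (G : Type*) [TopologicalSpace G] [TopGroupoid G]

/-- `G` is effective if the interior of `Iso(G) \ G⁽⁰⁾` is empty. -/
def IsEffective : Prop := interior (Iso G \ unitSpace G) = ∅

/-- `G` is minimal if `G⁽⁰⁾` has no nontrivial open invariant subsets (open in `G⁽⁰⁾`). -/
def IsMinimal : Prop :=
  ∀ U ⊆ unitSpace G, IsOpen ((↑) ⁻¹' U : Set (unitSpace G)) → IsInvariant U →
    U = ∅ ∨ U = unitSpace G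

open AlgGroupoid TopGroupoid

theorem continuous_r : Continuous (r : G → G) :=
  continuousOn_mul.comp_continuous (f := fun a : G => (a, inv a))
    (continuous_id.prodMk continuous_inversion) comp_inv

theorem continuous_s : Continuous (s : G → G) :=
  continuousOn_mul.comp_continuous (f := fun a : G => (inv a, a))
    (continuous_inversion.prodMk continuous_id) inv_comp

end Topological

section Algebra

variable (R : Type*) [CommRing R] (G : Type*) [TopologicalSpace G]

/-- The `R`-module of locally constant functions `G → R` with compact support. -/
def functionModule : Submodule R (G → R) where
  carrier := {f | IsLocallyConstant f ∧ HasCompactSupport f}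
  add_mem' hf hg := ⟨hf.1.add hg.1, hf.2.add hg.2⟩
  zero_mem' := ⟨IsLocallyConstant.const 0, HasCompactSupport.zero⟩
  smul_mem' c _ hf := ⟨hf.1.comp (c • ·), hf.2.comp_left (g := (c • ·)) (smul_zero c)⟩

/-- The Steinberg algebra `A_R(G)`: locally constant functions `G → R` with compact support,
with pointwise addition and scalar multiplication, and (below) with convolution as product. -/
def SteinbergAlgebra : Type _ := functionModule R G

namespace SteinbergAlgebra

instance : AddCommGroup (SteinbergAlgebra R G) := inferInstanceAs (AddCommGroup (functionModule R G))

instance : Module R (SteinbergAlgebra R G) := inferInstanceAs (Module R (functionModule R G))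

instance : FunLike (SteinbergAlgebra R G) G R where
  coe f := f.1
  coe_injective := Subtype.val_injective

variable {R G}

@[ext] theorem ext {f g : SteinbergAlgebra R G} (h : ∀ a, f a = g a) : f = g := DFunLike.ext _ _ h

@[simp] theorem zero_apply (a : G) : (0 : SteinbergAlgebra R G) a = 0 := rfl

@[simp] theorem add_apply (f g : SteinbergAlgebra R G) (a : G) : (f + g) a = f a + g a := rfl

@[simp] theorem smul_apply (c : R) (f : SteinbergAlgebra R G) (a : G) : (c • f) a = c * f a := rfl

theorem isLocallyConstant (f : SteinbergAlgebra R G) : IsLocallyConstant f := f.2.1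

theorem hasCompactSupport (f : SteinbergAlgebra R G) : HasCompactSupport f := f.2.2

/-- A locally constant function with compact support, cut down to a clopen set. -/
noncomputable def cut (f : SteinbergAlgebra R G) (B : Set G) (hB : IsClopen B) :
    SteinbergAlgebra R G :=
  ⟨B.indicator f, by
    constructor
    · rw [IsLocallyConstant.iff_eventually_eq]
      intro a
      have hf := (IsLocallyConstant.iff_eventually_eq _).1 f.isLocallyConstant a
      by_cases ha : a ∈ B
      · filter_upwards [hf, hB.isOpen.mem_nhds ha] with y hy hy'
        simp [ha, hy', hy]
      · filter_upwards [hB.compl.isOpen.mem_nhds ha] with y hy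
        rw [indicator_of_notMem ha, indicator_of_notMem hy]
    · refine f.hasCompactSupport.mono fun a ha => ?_
      intro h
      exact ha (by simp [indicator, h])⟩

@[simp] theorem cut_apply (f : SteinbergAlgebra R G) (B : Set G) (hB : IsClopen B) (a : G) :
    f.cut B hB a = B.indicator f a := rfl

/-- The characteristic function `1_K` of a compact open set `K`. -/
noncomputable def char [T2Space G] (R : Type*) [CommRing R] (K : Set G) (hc : IsCompact K)
    (ho : IsOpen K) : SteinbergAlgebra R G :=
  ⟨K.indicator 1, by
    constructor
    · rw [IsLocallyConstant.iff_eventually_eq]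
      intro a
      by_cases ha : a ∈ K
      · filter_upwards [ho.mem_nhds ha] with y hy
        simp [ha, hy]
      · filter_upwards [hc.isClosed.isOpen_compl.mem_nhds ha] with y hy
        rw [indicator_of_notMem ha, indicator_of_notMem hy]
    · exact HasCompactSupport.intro hc fun a ha => indicator_of_notMem ha _⟩

section Convolution

open AlgGroupoid TopGroupoid

/-- The convolution `(f * g)(a) = ∑_{r(b) = r(a)} f(b) g(b⁻¹ a)`. For `f ∈ A_R(G)` with `G` ample
only finitely many terms are nonzero, see `finite_fibre`. -/
noncomputable def conv {G : Type*} [AlgGroupoid G] (f g : G → R) (a : G) : R :=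
  ∑ᶠ b ∈ {b : G | r b = r a}, f b * g (mul (inv b) a)

variable [AmpleGroupoid G]

theorem _root_.Steinberg.IsOpenBisection.injOn_r {B : Set G} (h : IsOpenBisection B) :
    InjOn r B := injOn_iff_injective.2 h.isOpenEmbedding_r.injective

theorem conv_zero_left (g : G → R) : conv (0 : G → R) g = 0 := by
  funext a; simp [conv]

theorem conv_zero_right (f : G → R) : conv f (0 : G → R) = 0 := by
  funext a; simp [conv]

/-- Convolution with a function supported in a bisection, at a point met by the bisection. -/
theorem conv_of_mem {f g : G → R} {B : Set G} (hB : IsOpenBisection B) (hf : ∀ a ∉ B, f a = 0)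
    {a b : G} (hb : b ∈ B) (hab : r b = r a) : conv f g a = f b * g (mul (inv b) a) := by
  have h : ∀ c : G, c ≠ b → (∑ᶠ _ : r c = r a, f c * g (mul (inv c) a) : R) = 0 := by
    intro c hc
    by_cases hca : r c = r a
    · have : c ∉ B := fun hcB => hc (hB.injOn_r hcB hb (hca.trans hab.symm))
      simp [hf c this]
    · simp [hca]
  rw [conv]
  refine (finsum_eq_single _ b h).trans ?_
  simp [hab]

theorem conv_of_notMem {f g : G → R} {B : Set G} (hf : ∀ a ∉ B, f a = 0)
    {a : G} (ha : r a ∉ r '' B) : conv f g a = 0 := by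
  refine finsum_mem_eq_zero_of_forall_eq_zero fun b hb => ?_
  rw [hf b fun h => ha ⟨b, h, hb⟩, zero_mul]

variable [T2Space G]

/-- Induction on the number of compact open bisections that cover the support. -/
theorem induction_bisection {P : SteinbergAlgebra R G → Prop} (h0 : P 0)
    (hadd : ∀ f g, P f → P g → P (f + g))
    (hB : ∀ f (B : Set G), IsCompact B → IsOpenBisection B → (∀ a ∉ B, f a = 0) → P f)
    (f : SteinbergAlgebra R G) : P f := by
  have key : ∀ t : Set (Set G), t.Finite → (∀ B ∈ t, IsCompact B ∧ IsOpenBisection B) →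
      ∀ f : SteinbergAlgebra R G, (∀ a ∉ ⋃₀ t, f a = 0) → P f := by
    intro t ht
    induction t, ht using Set.Finite.induction_on with
    | empty =>
      intro _ f hf
      have : f = 0 := by ext a; exact hf a (by simp)
      exact this ▸ h0
    | @insert B t _ _ ih =>
      intro hb f hf
      have hBc := hb B (mem_insert _ _)
      have hcl : IsClopen B := ⟨hBc.1.isClosed, hBc.2.isOpen⟩
      have e : f = f.cut B hcl + f.cut Bᶜ hcl.compl := by
        ext a; by_cases ha : a ∈ B <;> simp [ha]
      rw [e]
      refine hadd _ _ (hB _ B hBc.1 hBc.2 fun a ha => by simp [ha]) ?_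
      refine ih (fun B' hB' => hb B' (mem_insert_of_mem _ hB')) _ fun a ha => ?_
      by_cases haB : a ∈ B
      · simp [haB]
      · rw [cut_apply, indicator_of_mem (show a ∈ Bᶜ from haB)]
        exact hf a (by simpa [haB] using ha)
  obtain ⟨t, htB, htf, hcov⟩ := f.hasCompactSupport.elim_finite_subcover_image
    (b := {B : Set G | IsCompact B ∧ IsOpenBisection B}) (c := id)
    (fun B hB => hB.2.isOpen) (by
      intro a _
      obtain ⟨B, hB, haB, _⟩ :=
        (AmpleGroupoid.isTopologicalBasis (G := G)).exists_subset_of_mem_open (mem_univ a)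
          isOpen_univ
      exact mem_biUnion hB haB)
  refine key t htf (fun B hB => htB hB) f fun a ha => ?_
  by_contra h
  have := hcov (subset_tsupport _ h)
  simp only [id, mem_iUnion, exists_prop] at this
  exact ha (by simpa using this)

/-- The sum that defines the convolution is finite. -/
theorem finite_fibre (f : SteinbergAlgebra R G) (u : G) : {b | r b = u ∧ f b ≠ 0}.Finite := by
  induction f using induction_bisection with
  | h0 => simp
  | hadd f g hf hg =>
    refine (hf.union hg).subset ?_
    rintro b ⟨hb, hb'⟩
    by_cases h : f b = 0
    · right; exact ⟨hb, by simpa [h] using hb'⟩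
    · left; exact ⟨hb, h⟩
  | hB f B _ hB hf =>
    refine Set.Subsingleton.finite ?_
    rintro b ⟨hb, hb'⟩ c ⟨hc, hc'⟩
    exact hB.injOn_r (by_contra fun h => hb' (hf b h)) (by_contra fun h => hc' (hf c h))
      (hb.trans hc.symm)

theorem finite_terms (f : SteinbergAlgebra R G) (g : G → R) (a : G) :
    ({b : G | r b = r a} ∩ Function.support fun b => f b * g (mul (inv b) a)).Finite := by
  refine (f.finite_fibre (r a)).subset ?_
  rintro b ⟨hb, hb'⟩
  exact ⟨hb, left_ne_zero_of_mul hb'⟩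

theorem mul_finsum_terms (c : R) (f : SteinbergAlgebra R G) (g : G → R) (a : G) :
    c * (∑ᶠ b ∈ {b : G | r b = r a}, f b * g (mul (inv b) a)) =
      ∑ᶠ b ∈ {b : G | r b = r a}, c * (f b * g (mul (inv b) a)) := by
  rw [← finsum_mem_inter_support, finsum_mem_eq_finite_toFinset_sum _ (f.finite_terms g a),
    Finset.mul_sum]
  refine (finsum_mem_eq_sum_of_inter_support_eq _ ?_).symm
  ext b; simp only [mem_inter_iff, Function.mem_support, Finite.coe_toFinset, mem_ofPred_eq]
  constructor
  · rintro ⟨h, h'⟩; exact ⟨⟨h, right_ne_zero_of_mul h'⟩, h'⟩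
  · rintro ⟨⟨h, _⟩, h'⟩; exact ⟨h, h'⟩

theorem conv_add_left (f f' : SteinbergAlgebra R G) (g : G → R) :
    conv (f + f' : SteinbergAlgebra R G) g = conv f g + conv f' g := by
  funext a
  simp only [conv, Pi.add_apply]
  rw [← finsum_mem_add_distrib' (f.finite_terms g a) (f'.finite_terms g a)]
  simp [add_mul]

theorem conv_add_right (f : SteinbergAlgebra R G) (g g' : G → R) :
    conv f (g + g') = conv f g + conv f g' := by
  funext a
  simp only [conv, Pi.add_apply]
  rw [← finsum_mem_add_distrib' (f.finite_terms g a) (f.finite_terms g' a)]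
  simp [mul_add]

theorem conv_isLocallyConstant (f g : SteinbergAlgebra R G) : IsLocallyConstant (conv f g) := by
  induction f using induction_bisection with
  | h0 =>
    have : conv (0 : SteinbergAlgebra R G) g = (0 : G → R) := conv_zero_left g
    rw [this]; exact IsLocallyConstant.const 0
  | hadd f f' h h' => rw [conv_add_left]; exact h.add h'
  | hB f B hc hB hf =>
    rw [IsLocallyConstant.iff_eventually_eq]
    intro a
    by_cases ha : r a ∈ r '' B
    · obtain ⟨b, hb, hba⟩ := ha
      have hfb := (IsLocallyConstant.iff_eventually_eq _).1 f.isLocallyConstant b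
      have hcont : ContinuousOn (fun p : G × G => mul (inv p.1) p.2) {p | r p.1 = r p.2} :=
        continuousOn_mul.comp (f := fun p : G × G => (inv p.1, p.2))
          ((continuous_inversion.comp continuous_fst).prodMk continuous_snd).continuousOn
          fun p hp => inv_comp_of hp
      have h1 := (hcont (b, a) hba).eventually
        ((IsLocallyConstant.iff_eventually_eq _).1 g.isLocallyConstant (mul (inv b) a))
      rw [eventually_nhdsWithin_iff, nhds_prod_eq] at h1
      obtain ⟨p, hp, q, hq, h1⟩ := Filter.eventually_prod_iff.1 h1
      have h2 : ∀ᶠ x in 𝓝 b, x ∈ B ∧ f x = f b ∧ p x :=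
        Filter.Eventually.and (hB.isOpen.mem_nhds hb) (hfb.and hp)
      obtain ⟨V, hV, hVo, hbV⟩ := eventually_nhds_iff.1 h2
      have h3 : IsOpen (r '' V) := by
        have := hB.isOpenEmbedding_r.isOpenMap _ (hVo.preimage continuous_subtype_val)
        convert this using 1
        ext u; constructor
        · rintro ⟨x, hx, rfl⟩; exact ⟨⟨x, (hV x hx).1⟩, hx, rfl⟩
        · rintro ⟨x, hx, rfl⟩; exact ⟨x, hx, rfl⟩
      have h4 := (continuous_r G).continuousAt.eventually
        (h3.mem_nhds (x := r a) ⟨b, hbV, hba⟩)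
      filter_upwards [h4, hq] with y ⟨x, hx, hxy⟩ hqy
      obtain ⟨hxB, hxf, hxp⟩ := hV x hx
      rw [conv_of_mem hB hf hxB hxy, conv_of_mem hB hf hb hba, hxf]
      congr 1
      exact h1 hxp hqy hxy
    · have hcl : IsClosed (r '' B) := (hc.image (continuous_r G)).isClosed
      filter_upwards [(continuous_r G).continuousAt.eventually (hcl.isOpen_compl.mem_nhds ha)]
        with y hy
      rw [conv_of_notMem hf ha, conv_of_notMem hf hy]

theorem conv_hasCompactSupport (f g : SteinbergAlgebra R G) : HasCompactSupport (conv f g) := by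
  have hcl : IsClosed {p : G × G | Comp p.1 p.2} := by
    simp only [comp_iff]
    exact isClosed_eq ((continuous_s G).comp continuous_fst) ((continuous_r G).comp continuous_snd)
  have hK : IsCompact ((fun p : G × G => mul p.1 p.2) ''
      ((tsupport f ×ˢ tsupport g) ∩ {p | Comp p.1 p.2})) :=
    ((f.hasCompactSupport.prod g.hasCompactSupport).inter_right hcl).image_of_continuousOn
      (continuousOn_mul.mono inter_subset_right)
  refine HasCompactSupport.intro hK fun a ha => ?_
  refine finsum_mem_eq_zero_of_forall_eq_zero fun b hb => ?_
  by_contra h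
  refine ha ⟨(b, mul (inv b) a), ⟨⟨subset_tsupport _ (left_ne_zero_of_mul h),
    subset_tsupport _ (right_ne_zero_of_mul h)⟩, ?_⟩, mul_inv_mul hb⟩
  exact comp_mul_right (comp_inv b) (inv_comp_of hb)

noncomputable instance : Mul (SteinbergAlgebra R G) where
  mul f g := ⟨conv f g, conv_isLocallyConstant f g, conv_hasCompactSupport f g⟩

theorem coe_mul (f g : SteinbergAlgebra R G) : ⇑(f * g) = conv f g := rfl

theorem mul_apply (f g : SteinbergAlgebra R G) (a : G) :
    (f * g) a = ∑ᶠ b ∈ {b : G | r b = r a}, f b * g (mul (inv b) a) := rfl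

protected theorem add_mul (f f' g : SteinbergAlgebra R G) : (f + f') * g = f * g + f' * g :=
  DFunLike.coe_injective (conv_add_left f f' g)

protected theorem mul_add (f g g' : SteinbergAlgebra R G) : f * (g + g') = f * g + f * g' :=
  DFunLike.coe_injective (conv_add_right f g g')

protected theorem zero_mul (g : SteinbergAlgebra R G) : 0 * g = 0 :=
  DFunLike.coe_injective (conv_zero_left g)

protected theorem mul_zero (f : SteinbergAlgebra R G) : f * 0 = 0 :=
  DFunLike.coe_injective (conv_zero_right f)

protected theorem mul_assoc (f g h : SteinbergAlgebra R G) : f * g * h = f * (g * h) := by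
  induction f using induction_bisection with
  | h0 => simp only [SteinbergAlgebra.zero_mul]
  | hadd f f' hf hf' => simp only [SteinbergAlgebra.add_mul, hf, hf']
  | hB f B _ hB hf =>
    ext a
    rw [coe_mul f (g * h)]
    by_cases ha : r a ∈ r '' B
    · obtain ⟨b, hb, hba⟩ := ha
      rw [conv_of_mem hB hf hb hba, mul_apply, mul_apply,
        mul_finsum_terms (f b) g h]
      refine (finsum_mem_eq_of_bijOn (fun d => mul b d) ⟨?_, ?_, ?_⟩ ?_).symm
      · intro d hd
        have hd : r d = r (mul (inv b) a) := hd
        rw [r_mul (inv_comp_of hba), r_inv] at hd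
        exact (r_mul (comp_iff.2 hd.symm)).trans hba
      · intro d hd d' hd' e
        have hd : r d = r (mul (inv b) a) := hd
        have hd' : r d' = r (mul (inv b) a) := hd'
        rw [r_mul (inv_comp_of hba), r_inv] at hd hd'
        have e : mul b d = mul b d' := e
        rw [← cancel_left (comp_iff.2 hd.symm), e,
          cancel_left (comp_iff.2 hd'.symm)]
      · intro c hc
        have hc : r c = r a := hc
        refine ⟨mul (inv b) c, ?_, mul_inv_mul (hba.trans hc.symm)⟩
        change r _ = r _
        rw [r_mul (inv_comp_of hba), r_mul (inv_comp_of (hba.trans hc.symm))]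
      · intro d hd
        have hd : r d = r (mul (inv b) a) := hd
        rw [r_mul (inv_comp_of hba), r_inv] at hd
        have hbd : Comp b d := comp_iff.2 hd.symm
        rw [coe_mul, conv_of_mem hB hf hb (r_mul hbd).symm, cancel_left hbd,
          inv_mul_mul hbd hba, _root_.mul_assoc]
    · rw [conv_of_notMem hf ha]
      refine finsum_mem_eq_zero_of_forall_eq_zero fun c hc => ?_
      have hc : r c = r a := hc
      rw [coe_mul, conv_of_notMem hf (hc ▸ ha), MulZeroClass.zero_mul]

noncomputable instance : NonUnitalRing (SteinbergAlgebra R G) where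
  left_distrib := SteinbergAlgebra.mul_add
  right_distrib := SteinbergAlgebra.add_mul
  zero_mul := SteinbergAlgebra.zero_mul
  mul_zero := SteinbergAlgebra.mul_zero
  mul_assoc := SteinbergAlgebra.mul_assoc

instance : IsScalarTower R (SteinbergAlgebra R G) (SteinbergAlgebra R G) where
  smul_assoc c f g := by
    ext a
    simp only [smul_eq_mul, smul_apply, mul_apply]
    rw [mul_finsum_terms c f g a]
    simp only [_root_.mul_assoc]

instance : SMulCommClass R (SteinbergAlgebra R G) (SteinbergAlgebra R G) where
  smul_comm c f g := by
    ext a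
    simp only [smul_eq_mul, smul_apply, mul_apply]
    rw [mul_finsum_terms c f g a]
    simp only [mul_left_comm]

end Convolution

end SteinbergAlgebra

variable {R G} [T2Space G] [AmpleGroupoid G]

/-- A (two-sided) ideal `I` of `A_R(G)` is basic if `c · 1_K ∈ I`, for a nonzero `c ∈ R` and a
compact open `K ⊆ G⁽⁰⁾`, implies `1_K ∈ I`. -/
def IsBasicIdeal (I : TwoSidedIdeal (SteinbergAlgebra R G)) : Prop :=
  ∀ (c : R), c ≠ 0 → ∀ (K : Set G) (hc : IsCompact K) (ho : IsOpen K), K ⊆ unitSpace G →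
    c • SteinbergAlgebra.char R K hc ho ∈ I → SteinbergAlgebra.char R K hc ho ∈ I

variable (R G) in
/-- `A_R(G)` is basically simple if it has no basic ideals other than `0` and `A_R(G)`. -/
def IsBasicallySimple : Prop :=
  ∀ I : TwoSidedIdeal (SteinbergAlgebra R G), IsBasicIdeal I → I = ⊥ ∨ I = ⊤

end Algebra

end Steinberg

/-! `A_R(G)` acts on functions on the unit space by `(f φ)(u) = ∑_{r(b) = u} f(b) φ(s(b))`. The
kernel of this action contains `c 1_K` with `c ≠ 0` only for `K = ∅`, so it is a basic ideal and is
proper as soon as `G` is nonempty. A compact open bisection `B` of isotropy arrows acts as `r(B)`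
does, so `1_B - 1_{r(B)}` lies in the kernel; it is nonzero if `B` is nonempty and misses the units.
Hence basic simplicity forces effectiveness. It forces minimality because the functions supported
over an open invariant set of units form a basic ideal, which determines that set.

Conversely, let `I` be a nonzero basic ideal. Translating a nonzero element by a bisection gives `g
∈ I` with a nonzero value `c` at a unit. Effectiveness yields a small set `K` of units on which `g =
c` and over which `g` has no other support (`IsEffective.exists_isOpen_forall_eq_zero`), so `1_K * g
* 1_K = c 1_K`. Basicness gives `1_K ∈ I`. The units covered by such `K` form an open invariant set
(`isInvariant_idealUnits`), by minimality all of `G⁽⁰⁾`; local units then give `I = A_R(G)`. -/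

namespace Steinberg

open Set Topology AlgGroupoid TopGroupoid

/-! ### Groupoid identities for range, source and inverse. -/

section Algebraic

variable {G : Type*} [AlgGroupoid G]

theorem r_r (a : G) : r (r a) = r a := r_mul (comp_inv a)

theorem s_r (a : G) : s (r a) = r a := by
  have h : Comp (r a) a := comp_mul_left (comp_inv a) (inv_comp a)
  exact comp_iff.1 h

theorem r_s (a : G) : r (s a) = s a := by rw [← r_inv, r_r]

theorem r_mul_self (a : G) : mul (r a) a = a := by
  have := cancel_right (comp_inv a)
  rwa [inv_invol] at this

theorem mul_s_self (a : G) : mul a (s a) = a := by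
  have := cancel_left (inv_comp a)
  rwa [inv_invol] at this

theorem mem_unitSpace_iff_r {a : G} : a ∈ unitSpace G ↔ r a = a :=
  ⟨by rintro ⟨b, rfl⟩; exact r_r b, fun h => ⟨a, h⟩⟩

theorem s_eq_of_mem_unitSpace {a : G} (h : a ∈ unitSpace G) : s a = a := by
  obtain ⟨b, rfl⟩ := h
  exact s_r b

theorem inv_eq_of_mem_unitSpace {a : G} (h : a ∈ unitSpace G) : inv a = a := by
  have h1 := mul_s_self (inv a)
  rw [s_inv, mem_unitSpace_iff_r.1 h] at h1
  rw [← h1]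
  exact s_eq_of_mem_unitSpace h

theorem s_mul {a b : G} (h : Comp a b) : s (mul a b) = s b := by
  rw [comp_iff.1 (comp_mul_left h (comp_inv b)), r_inv]

theorem s_inv_mul {a b : G} (h : r a = r b) : s (mul (inv a) b) = s b :=
  s_mul (inv_comp_of h)

theorem r_inv_mul {a b : G} (h : r a = r b) : r (mul (inv a) b) = s a := by
  rw [r_mul (inv_comp_of h), r_inv]

/-- A unit is its own range, so `a⁻¹b = s(a)` and `b = a(a⁻¹b) = a s(a) = a`. -/
theorem eq_of_inv_mul_mem_unitSpace {a b : G} (h : r a = r b)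
    (hu : mul (inv a) b ∈ unitSpace G) : a = b := by
  have h1 := mul_inv_mul h
  rwa [← mem_unitSpace_iff_r.1 hu, r_inv_mul h, mul_s_self] at h1

theorem inv_inv_mul {a b : G} (h : r a = r b) : inv (mul (inv a) b) = mul (inv b) a := by
  have h1 := inv_mul_mul (c := s a) (inv_comp_of h) (by rw [r_inv, r_s])
  have h2 : mul (inv (mul (inv a) b)) (s a) = inv (mul (inv a) b) := by
    have := mul_s_self (inv (mul (inv a) b))
    rwa [s_inv, r_inv_mul h] at this
  rw [h2, inv_invol, mul_s_self] at h1
  exact h1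

theorem IsInvariant.r_mem_iff {U : Set G} (h : IsInvariant U) {a : G} : r a ∈ U ↔ s a ∈ U := by
  have key : ∀ a : G, s a ∈ U → r a ∈ U := fun a ha => by
    rw [← (show r '' (s ⁻¹' U) = U from h)]
    exact ⟨a, ha, rfl⟩
  refine ⟨fun ha => ?_, key a⟩
  rw [← r_inv]
  exact key _ (by rwa [s_inv])

end Algebraic

/-! ### Topology of the unit space and of bisections. -/

section Topological

variable {G : Type*} [TopologicalSpace G]

theorem isClosed_unitSpace [T2Space G] [TopGroupoid G] : IsClosed (unitSpace G) := by
  have : unitSpace G = {a | r a = a} := ext fun a => mem_unitSpace_iff_r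
  rw [this]
  exact isClosed_eq (continuous_r G) continuous_id

theorem isOpen_image_r [TopGroupoid G] {B : Set G} (hB : IsOpenBisection B) {V : Set G}
    (hV : IsOpen V) (hVB : V ⊆ B) : IsOpen (r '' V) := by
  have := hB.isOpenEmbedding_r.isOpenMap _ (hV.preimage continuous_subtype_val)
  convert this using 1
  ext u; constructor
  · rintro ⟨x, hx, rfl⟩; exact ⟨⟨x, hVB hx⟩, hx, rfl⟩
  · rintro ⟨x, hx, rfl⟩; exact ⟨x, hx, rfl⟩

theorem IsOpenBisection.injOn_s [TopGroupoid G] {B : Set G} (h : IsOpenBisection B) :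
    InjOn s B :=
  injOn_iff_injective.2 h.isOpenEmbedding_s.injective

theorem isCompact_preimage_inv [TopGroupoid G] {B : Set G} (hc : IsCompact B) :
    IsCompact (inv ⁻¹' B) := by
  have : inv ⁻¹' B = inv '' B := by
    ext a
    exact ⟨fun h => ⟨_, h, inv_invol a⟩, by rintro ⟨b, hb, rfl⟩; simpa [inv_invol] using hb⟩
  rw [this]
  exact hc.image continuous_inversion

variable [AmpleGroupoid G]

theorem exists_isCompact_isOpenBisection {W : Set G} (hW : IsOpen W) {a : G} (ha : a ∈ W) :
    ∃ B, IsCompact B ∧ IsOpenBisection B ∧ a ∈ B ∧ B ⊆ W := by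
  obtain ⟨B, hB, haB, hBW⟩ :=
    (AmpleGroupoid.isTopologicalBasis (G := G)).exists_subset_of_mem_open ha hW
  exact ⟨B, hB.1, hB.2, haB, hBW⟩

variable (G) in
-- A unit `u` in an open bisection `B` equals `r(u)`, so it lies in the open set `r(B)` of units.
theorem isOpen_unitSpace : IsOpen (unitSpace G) := by
  rw [isOpen_iff_mem_nhds]
  intro u hu
  obtain ⟨B, -, hB, huB, -⟩ := exists_isCompact_isOpenBisection isOpen_univ (mem_univ u)
  refine Filter.mem_of_superset ((isOpen_image_r hB hB.isOpen subset_rfl).mem_nhds ?_)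
    (image_subset_range r B)
  exact ⟨u, huB, mem_unitSpace_iff_r.1 hu⟩

theorem isOpenBisection_of_subset_unitSpace {K : Set G} (ho : IsOpen K) (hK : K ⊆ unitSpace G) :
    IsOpenBisection K where
  isOpen := ho
  isOpenEmbedding_r := by
    have : K.domRestrict r = ((↑) : K → G) := funext fun a => mem_unitSpace_iff_r.1 (hK a.2)
    rw [this]
    exact ho.isOpenEmbedding_subtypeVal
  isOpenEmbedding_s := by
    have : K.domRestrict s = ((↑) : K → G) := funext fun a => s_eq_of_mem_unitSpace (hK a.2)
    rw [this]
    exact ho.isOpenEmbedding_subtypeVal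

end Topological

/-! ### Convolution with sets of units and with functions of the range. -/

namespace SteinbergAlgebra

/-- Functions that factor through the range map are preserved by convolution on the left. -/
theorem conv_comp_r {R : Type*} [CommRing R] {G : Type*} [AlgGroupoid G]
    (f φ : G → R) :
    conv f (φ ∘ r) = conv f (φ ∘ r) ∘ r := by
  ext a
  simp only [conv, Function.comp_apply, r_r]
  -- `r(b⁻¹a) = s(b)` no longer involves `a`.
  refine finsum_mem_congr rfl fun b hb => ?_
  have hb : r b = r a := hb
  rw [r_inv_mul hb, r_inv_mul (hb.trans (r_r a).symm)]

variable {R : Type*} [CommRing R] {G : Type*} [TopologicalSpace G] [T2Space G]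

theorem char_apply (K : Set G) (hc : IsCompact K) (ho : IsOpen K) (a : G) :
    char R K hc ho a = K.indicator 1 a := rfl

theorem char_of_mem {K : Set G} (hc : IsCompact K) (ho : IsOpen K) {a : G} (ha : a ∈ K) :
    char R K hc ho a = 1 := by simp [char_apply, ha]

theorem char_of_notMem {K : Set G} (hc : IsCompact K) (ho : IsOpen K) {a : G} (ha : a ∉ K) :
    char R K hc ho a = 0 := by simp [char_apply, ha]

variable [AmpleGroupoid G]

/-- Convolution by the characteristic function of a set of units restricts ranges. -/
theorem conv_char_left {K : Set G} (hc : IsCompact K) (ho : IsOpen K) (hK : K ⊆ unitSpace G)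
    (g : G → R) (a : G) : conv (char R K hc ho) g a = (r ⁻¹' K).indicator g a := by
  have hsupp : ∀ a ∉ K, char R K hc ho a = 0 := fun a ha => char_of_notMem hc ho ha
  by_cases ha : r a ∈ K
  · rw [conv_of_mem (isOpenBisection_of_subset_unitSpace ho hK) hsupp ha (r_r a),
      char_of_mem hc ho ha, inv_eq_of_mem_unitSpace (hK ha), r_mul_self, one_mul]
    simp [ha]
  · rw [conv_of_notMem hsupp]
    · simp [ha]
    · rintro ⟨u, hu, hua⟩
      exact ha (by rwa [← hua, mem_unitSpace_iff_r.1 (hK hu)])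

theorem char_mul_apply {K : Set G} (hc : IsCompact K) (ho : IsOpen K) (hK : K ⊆ unitSpace G)
    (f : SteinbergAlgebra R G) (a : G) :
    (char R K hc ho * f) a = (r ⁻¹' K).indicator f a :=
  conv_char_left hc ho hK f a

/-- Convolution by the characteristic function of a set of units restricts sources. -/
theorem mul_char_apply {K : Set G} (hc : IsCompact K) (ho : IsOpen K) (hK : K ⊆ unitSpace G)
    (f : SteinbergAlgebra R G) (a : G) :
    (f * char R K hc ho) a = (s ⁻¹' K).indicator f a := by
  rw [mul_apply]
  -- Only `b = a` contributes: `b⁻¹a ∈ K` is a unit, which forces `b = a`.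
  refine (finsum_eq_single _ a fun b hb => ?_).trans ?_
  · by_cases hba : r b = r a
    · have : mul (inv b) a ∉ K := fun h => hb (eq_of_inv_mul_mem_unitSpace hba (hK h))
      simp [char_of_notMem hc ho this]
    · simp [hba]
  · change ∑ᶠ _ : r a = r a, f a * char R K hc ho (s a) = _
    by_cases ha : s a ∈ K
    · simp [char_of_mem hc ho ha, ha]
    · simp [char_of_notMem hc ho ha, ha]

/-- Associativity of the convolution for an arbitrary function as third factor. -/
theorem conv_assoc (f g : SteinbergAlgebra R G) (h : G → R) :
    conv (f * g : SteinbergAlgebra R G) h = conv f (conv g h) := by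
  induction f using induction_bisection with
  | h0 =>
    rw [SteinbergAlgebra.zero_mul]
    exact (conv_zero_left h).trans (conv_zero_left _).symm
  | hadd f f' hf hf' => rw [SteinbergAlgebra.add_mul, conv_add_left, conv_add_left, hf, hf']
  | hB f B _ hB hf =>
    ext a
    by_cases ha : r a ∈ r '' B
    · obtain ⟨b, hb, hba⟩ := ha
      rw [conv_of_mem hB hf hb hba, conv, conv, mul_finsum_terms (f b) g h]
      have hr : ∀ {d}, r d = r (mul (inv b) a) → Comp b d := fun hd => by
        rw [r_inv_mul hba] at hd
        exact comp_iff.2 hd.symm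
      refine (finsum_mem_eq_of_bijOn (fun d => mul b d) ⟨?_, ?_, ?_⟩ ?_).symm
      · intro d hd
        exact (r_mul (hr hd)).trans hba
      · intro d hd d' hd' e
        have e : mul b d = mul b d' := e
        rw [← cancel_left (hr hd), e, cancel_left (hr hd')]
      · intro c hc
        have hc : r c = r a := hc
        refine ⟨mul (inv b) c, ?_, mul_inv_mul (hba.trans hc.symm)⟩
        change r _ = r _
        rw [r_inv_mul hba, r_inv_mul (hba.trans hc.symm)]
      · intro d hd
        have hbd : Comp b d := hr hd
        rw [coe_mul, conv_of_mem hB hf hb (r_mul hbd).symm, cancel_left hbd,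
          inv_mul_mul hbd hba, _root_.mul_assoc]
    · rw [conv_of_notMem hf ha]
      refine finsum_mem_eq_zero_of_forall_eq_zero fun c hc => ?_
      have hc : r c = r a := hc
      rw [coe_mul, conv_of_notMem hf (hc ▸ ha), MulZeroClass.zero_mul]

/-! ### The action on functions of units: basic simplicity implies effectiveness. -/

variable (R G) in
/-- The kernel of the action of `A_R(G)` on the functions on the unit space. -/
noncomputable def kernelIdeal : TwoSidedIdeal (SteinbergAlgebra R G) :=
  .mk' {f | ∀ φ : G → R, conv f (φ ∘ r) = 0}
    (fun φ => conv_zero_left _)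
    (fun {f g} hf hg φ => by rw [conv_add_left, hf, hg, add_zero])
    (fun {f} hf φ => by
      have h := conv_add_left f (-f) (φ ∘ r)
      rw [add_neg_cancel, hf φ, zero_add] at h
      exact h.symm.trans (conv_zero_left _))
    (fun {f g} hg φ => by rw [conv_assoc, hg, conv_zero_right])
    -- `g` maps `φ ∘ r` to a function that again factors through `r`, which `f` kills.
    (fun {f g} hf φ => by rw [conv_assoc, conv_comp_r, hf])

theorem mem_kernelIdeal {f : SteinbergAlgebra R G} :
    f ∈ kernelIdeal R G ↔ ∀ φ : G → R, conv f (φ ∘ r) = 0 :=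
  TwoSidedIdeal.mem_mk' _ _ _ _ _ _ _

/-- Acting on the constant function `1`, `c 1_K` gives the value `c` on `K`. -/
theorem eq_empty_of_smul_char_mem_kernelIdeal {c : R} (hc0 : c ≠ 0) {K : Set G}
    (hc : IsCompact K) (ho : IsOpen K) (hK : K ⊆ unitSpace G)
    (h : c • char R K hc ho ∈ kernelIdeal R G) : K = ∅ := by
  refine eq_empty_of_forall_notMem fun u hu => hc0 ?_
  have h1 := congrFun (mem_kernelIdeal.1 h fun _ => 1) u
  rw [conv_of_mem (isOpenBisection_of_subset_unitSpace ho hK)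
    (fun a ha => by rw [smul_apply, char_of_notMem hc ho ha, MulZeroClass.mul_zero]) hu rfl] at h1
  simpa [char_of_mem hc ho hu] using h1

theorem char_eq_zero {K : Set G} (hc : IsCompact K) (ho : IsOpen K) (hK : K = ∅) :
    char R K hc ho = 0 := by
  ext a
  exact char_of_notMem hc ho (by simp [hK])

theorem isBasicIdeal_kernelIdeal : IsBasicIdeal (kernelIdeal R G) := by
  intro c hc0 K hc ho hK h
  rw [char_eq_zero hc ho (eq_empty_of_smul_char_mem_kernelIdeal hc0 hc ho hK h)]
  exact zero_mem _

/-- At `r(b)` with `b ∈ B`, `1_B` produces `φ(s(b))` and `1_{r(B)}` produces `φ(r(b))`; these agree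
on isotropy. -/
theorem char_sub_char_mem_kernelIdeal {B : Set G} (hc : IsCompact B) (hB : IsOpenBisection B)
    (hiso : B ⊆ Iso G) (hc' : IsCompact (r '' B)) (ho' : IsOpen (r '' B)) :
    char R B hc hB.isOpen - char R (r '' B) hc' ho' ∈ kernelIdeal R G := by
  have key : ∀ φ : G → R,
      conv (char R B hc hB.isOpen) (φ ∘ r) = conv (char R (r '' B) hc' ho') (φ ∘ r) := by
    intro φ
    ext a
    rw [conv_char_left hc' ho' (image_subset_range r B)]
    have hsupp : ∀ a ∉ B, char R B hc hB.isOpen a = 0 := fun a ha => char_of_notMem _ _ ha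
    by_cases ha : r a ∈ r '' B
    · rw [indicator_of_mem (by exact ha)]
      obtain ⟨b, hb, hba⟩ := ha
      rw [conv_of_mem hB hsupp hb hba, char_of_mem hc hB.isOpen hb, one_mul, Function.comp_apply,
        Function.comp_apply, r_inv_mul hba, ← hba]
      exact congrArg φ (hiso hb)
    · rw [conv_of_notMem hsupp ha, indicator_of_notMem (by exact ha)]
  rw [mem_kernelIdeal]
  intro φ
  have h := conv_add_left (char R B hc hB.isOpen - char R (r '' B) hc' ho')
    (char R (r '' B) hc' ho') (φ ∘ r)
  rw [sub_add_cancel, key] at h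
  exact right_eq_add.1 h

end SteinbergAlgebra

open SteinbergAlgebra

variable {R : Type*} [CommRing R] {G : Type*} [TopologicalSpace G] [T2Space G] [AmpleGroupoid G]

theorem IsBasicallySimple.isEffective [Nontrivial R] (h : IsBasicallySimple R G) :
    IsEffective G := by
  by_contra hne
  obtain ⟨a, ha⟩ := nonempty_iff_ne_empty.2 hne
  obtain ⟨B, hc, hB, haB, hBi⟩ := exists_isCompact_isOpenBisection isOpen_interior ha
  have hBs := hBi.trans interior_subset
  have hc' : IsCompact (r '' B) := hc.image (continuous_r G)
  have ho' : IsOpen (r '' B) := isOpen_image_r hB hB.isOpen subset_rfl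
  rcases h _ isBasicIdeal_kernelIdeal with h | h
  · have h1 := char_sub_char_mem_kernelIdeal (R := R) hc hB (hBs.trans sdiff_subset) hc' ho'
    rw [h, TwoSidedIdeal.mem_bot, sub_eq_zero] at h1
    have h2 := DFunLike.congr_fun h1 a
    rw [char_of_mem _ _ haB, char_of_notMem] at h2
    · exact one_ne_zero h2
    · exact fun h3 => (hBs haB).2 (image_subset_range r B h3)
  · have h1 : (1 : R) • char R (r '' B) hc' ho' ∈ kernelIdeal R G := h ▸ trivial
    have h2 := eq_empty_of_smul_char_mem_kernelIdeal one_ne_zero hc' ho'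
      (image_subset_range r B) h1
    exact (h2 ▸ mem_image_of_mem r haB : r a ∈ (∅ : Set G))

/-! ### Reduction ideals: basic simplicity implies minimality. -/

variable (R) in
/-- The ideal of the functions supported on the reduction of `G` to an invariant set of units. -/
noncomputable def reductionIdeal (U : Set G) (hU : IsInvariant U) :
    TwoSidedIdeal (SteinbergAlgebra R G) :=
  .mk' {f | ∀ a, r a ∉ U → f a = 0}
    (fun a _ => rfl)
    (fun {f g} hf hg a ha => by rw [SteinbergAlgebra.add_apply, hf a ha, hg a ha, add_zero])
    (fun {f} hf a ha => by
      have h : (f + -f) a = f a + (-f) a := rfl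
      rw [add_neg_cancel, hf a ha, zero_add] at h
      exact h.symm)
    (fun {f g} hg a ha => by
      refine finsum_mem_eq_zero_of_forall_eq_zero fun b hb => ?_
      have hb : r b = r a := hb
      -- `r(b⁻¹a) = s(b)`, and invariance carries `r(b) ∉ U` over to `s(b) ∉ U`.
      rw [hg _ (by rwa [r_inv_mul hb, ← hU.r_mem_iff, hb]), MulZeroClass.mul_zero])
    (fun {f g} hf a ha => by
      refine finsum_mem_eq_zero_of_forall_eq_zero fun b hb => ?_
      have hb : r b = r a := hb
      rw [hf _ (by rwa [hb]), MulZeroClass.zero_mul])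

theorem mem_reductionIdeal {U : Set G} {hU : IsInvariant U} {f : SteinbergAlgebra R G} :
    f ∈ reductionIdeal R U hU ↔ ∀ a, r a ∉ U → f a = 0 :=
  TwoSidedIdeal.mem_mk' _ _ _ _ _ _ _

/-- Membership is a support condition, and `c 1_K` has the same support as `1_K`. -/
theorem isBasicIdeal_reductionIdeal {U : Set G} (hU : IsInvariant U) :
    IsBasicIdeal (reductionIdeal R U hU) := by
  intro c hc0 K hc ho _ h
  rw [mem_reductionIdeal] at h ⊢
  intro a ha
  by_cases haK : a ∈ K
  · have := h a ha
    rw [SteinbergAlgebra.smul_apply, char_of_mem hc ho haK, mul_one] at this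
    exact absurd this hc0
  · exact char_of_notMem hc ho haK

theorem IsBasicallySimple.isMinimal [Nontrivial R] (h : IsBasicallySimple R G) :
    IsMinimal G := by
  intro U hUs hUo hU
  have hUo : IsOpen U := by
    have := (isOpen_unitSpace G).isOpenMap_subtype_val _ hUo
    rwa [Subtype.image_preimage_coe, inter_eq_right.2 hUs] at this
  rcases h _ (isBasicIdeal_reductionIdeal (R := R) hU) with h | h
  · left
    refine eq_empty_of_forall_notMem fun u hu => ?_
    obtain ⟨K, hc, hK, huK, hKU⟩ := exists_isCompact_isOpenBisection hUo hu
    have h1 : char R K hc hK.isOpen ∈ reductionIdeal R U hU := by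
      rw [mem_reductionIdeal]
      refine fun a ha => char_of_notMem _ _ fun haK => ha ?_
      rw [mem_unitSpace_iff_r.1 (hUs (hKU haK))]
      exact hKU haK
    rw [h, TwoSidedIdeal.mem_bot] at h1
    have h2 := DFunLike.congr_fun h1 u
    rw [char_of_mem _ _ huK] at h2
    exact one_ne_zero h2
  · right
    refine hUs.antisymm fun u hu => ?_
    by_contra huU
    obtain ⟨K, hc, hK, huK, -⟩ := exists_isCompact_isOpenBisection isOpen_univ (mem_univ u)
    have h1 : char R K hc hK.isOpen ∈ reductionIdeal R U hU := h ▸ trivial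
    have h2 := mem_reductionIdeal.1 h1 u (by rwa [mem_unitSpace_iff_r.1 hu])
    rw [char_of_mem _ _ huK] at h2
    exact one_ne_zero h2

/-! ### Effectiveness: cutting elements down to the unit space. -/

/-- In an effective groupoid, every nonempty open set of units contains a nonempty open set over
which a given function vanishes off the unit space. -/
theorem IsEffective.exists_isOpen_forall_eq_zero (hG : IsEffective G) (f : SteinbergAlgebra R G) :
    ∀ V : Set G, IsOpen V → V.Nonempty → ∃ W ⊆ V, IsOpen W ∧ W.Nonempty ∧
      ∀ a ∉ unitSpace G, r a ∈ W → s a ∈ W → f a = 0 := by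
  induction f using induction_bisection with
  | h0 => exact fun V hV hne => ⟨V, subset_rfl, hV, hne, fun a _ _ _ => rfl⟩
  | hadd f g hf hg =>
    intro V hV hne
    obtain ⟨W, hWV, hWo, hWne, hW⟩ := hf V hV hne
    obtain ⟨W', hWW, hWo', hWne', hW'⟩ := hg W hWo hWne
    refine ⟨W', hWW.trans hWV, hWo', hWne', fun a ha h1 h2 => ?_⟩
    rw [SteinbergAlgebra.add_apply, hW a ha (hWW h1) (hWW h2), hW' a ha h1 h2, add_zero]
  | hB f B hc hB hf =>
    intro V hV hne
    set C := B ∩ (unitSpace G)ᶜ ∩ (r ⁻¹' V ∩ s ⁻¹' V) with hC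
    by_cases hCe : C = ∅
    · refine ⟨V, subset_rfl, hV, hne, fun a ha h1 h2 => hf a fun haB => ?_⟩
      have : a ∈ C := ⟨⟨haB, ha⟩, h1, h2⟩
      simp [hCe] at this
    · have hCo : IsOpen C := (hB.isOpen.inter isClosed_unitSpace.isOpen_compl).inter
        ((hV.preimage (continuous_r G)).inter (hV.preimage (continuous_s G)))
      -- Effectiveness enters here: a nonempty open set of non-units cannot consist of isotropy.
      obtain ⟨a, haC, ha⟩ : ∃ a ∈ C, s a ≠ r a := by
        by_contra! hcon
        have : C ⊆ interior (Iso G \ unitSpace G) :=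
          interior_maximal (fun a ha => ⟨hcon a ha, ha.1.2⟩) hCo
        exact hCe (subset_empty_iff.1 (this.trans hG.subset))
      obtain ⟨W₁, W₂, h1o, h2o, h1, h2, hd⟩ := t2_separation ha
      have hDo : IsOpen (C ∩ (s ⁻¹' W₁ ∩ r ⁻¹' W₂)) := hCo.inter
        ((h1o.preimage (continuous_s G)).inter (h2o.preimage (continuous_r G)))
      -- Let `D` be the part of `C` going from `W₁` to `W₂`, and take `W = r(D)`. If `b ∈ B` has
      -- both ends in `W`, injectivity of `r` on `B` puts `b` in `D`, so `s(b) ∈ W₁`; but `s(b) ∈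
      -- r(D) ⊆ W₂`.
      refine ⟨r '' (C ∩ (s ⁻¹' W₁ ∩ r ⁻¹' W₂)), ?_,
        isOpen_image_r hB hDo fun x hx => hx.1.1.1, ⟨r a, a, ⟨haC, h1, h2⟩, rfl⟩, ?_⟩
      · rintro _ ⟨x, hx, rfl⟩
        exact hx.1.2.1
      · rintro b - ⟨x, hx, hxb⟩ ⟨y, hy, hyb⟩
        refine hf b fun hbB => ?_
        have hxb : x = b := hB.injOn_r hx.1.1.1 hbB hxb
        subst hxb
        exact disjoint_left.1 hd hx.2.1 (hyb ▸ hy.2.2)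

/-- The convolution of `1_{B⁻¹}` with `f` translates the values of `f` on `B`. -/
theorem conv_char_inv_apply {B : Set G} (hc : IsCompact (inv ⁻¹' B)) (hB : IsOpenBisection B)
    (ho : IsOpen (inv ⁻¹' B)) (f : SteinbergAlgebra R G) {a : G} (ha : a ∈ B) :
    (char R (inv ⁻¹' B) hc ho * f) (s a) = f a := by
  rw [mul_apply]
  -- A contributing `b` has `b⁻¹ ∈ B` with the same source as `a`, so `b⁻¹ = a`.
  refine (finsum_eq_single _ (inv a) fun b hb => ?_).trans ?_
  · by_cases hba : r b = r (s a)
    · have : b ∉ inv ⁻¹' B := fun h => hb <| by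
        rw [← hB.injOn_s h ha (by rw [s_inv, hba, r_s]), inv_invol]
      simp [char_of_notMem hc ho this]
    · simp [hba]
  · have hmem : inv a ∈ inv ⁻¹' B := by simpa [inv_invol] using ha
    simp [char_of_mem hc ho hmem, r_inv, r_s, inv_invol, mul_s_self]

/-- This is `B B⁻¹ = r(B)`, which holds because `s` is injective on `B`. -/
theorem char_mul_char_inv {B : Set G} (hc : IsCompact B) (hB : IsOpenBisection B)
    (hc' : IsCompact (inv ⁻¹' B)) (ho' : IsOpen (inv ⁻¹' B))
    (hcr : IsCompact (r '' B)) (hor : IsOpen (r '' B)) :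
    char R B hc hB.isOpen * char R (inv ⁻¹' B) hc' ho' = char R (r '' B) hcr hor := by
  have hsupp : ∀ a ∉ B, char R B hc hB.isOpen a = 0 := fun a ha => char_of_notMem _ _ ha
  ext a
  rw [coe_mul]
  by_cases ha : r a ∈ r '' B
  · obtain ⟨b, hb, hba⟩ := ha
    rw [conv_of_mem hB hsupp hb hba, char_of_mem hc hB.isOpen hb, one_mul]
    have key : mul (inv b) a ∈ inv ⁻¹' B ↔ a ∈ r '' B := by
      rw [mem_preimage, inv_inv_mul hba]
      constructor
      · intro h
        -- Both `a⁻¹b` and `b` lie in `B` with the same source; their equality makes `a` a unit.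
        have h1 : mul (inv a) b = b := hB.injOn_s h hb (s_inv_mul hba.symm)
        have h2 : s a = r a := by
          rw [← hba, ← r_inv_mul hba.symm, h1]
        refine ⟨b, hb, ?_⟩
        have h3 : mul (mul (inv a) b) (inv b) = inv a := cancel_right (inv_comp_of hba.symm)
        rw [h1] at h3
        have h4 : inv a ∈ unitSpace G := ⟨b, h3⟩
        rw [← inv_invol a, inv_eq_of_mem_unitSpace h4]
        exact h3
      · rintro ⟨x, hx, rfl⟩
        rw [inv_eq_of_mem_unitSpace ⟨x, rfl⟩, ← r_r x, ← hba, r_mul_self]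
        exact hb
    by_cases h : a ∈ r '' B
    · rw [char_of_mem _ _ (key.2 h), char_of_mem _ _ h]
    · rw [char_of_notMem _ _ (mt key.1 h), char_of_notMem _ _ h]
  · rw [conv_of_notMem hsupp ha, char_of_notMem]
    rintro ⟨x, hx, rfl⟩
    exact ha ⟨x, hx, (r_r x).symm⟩

/-- A nonzero ideal of the Steinberg algebra of an effective groupoid contains a nonzero multiple
of the characteristic function of a nonempty compact open set of units. -/
theorem IsEffective.exists_smul_char_mem (hG : IsEffective G)
    {I : TwoSidedIdeal (SteinbergAlgebra R G)} (hI : I ≠ ⊥) :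
    ∃ (c : R) (K : Set G) (hc : IsCompact K) (ho : IsOpen K), c ≠ 0 ∧ K.Nonempty ∧
      K ⊆ unitSpace G ∧ c • char R K hc ho ∈ I := by
  obtain ⟨f, hfI, hf⟩ : ∃ f ∈ I, f ≠ 0 := by
    by_contra! hcon
    refine hI (eq_bot_iff.2 fun f hf => ?_)
    rw [TwoSidedIdeal.mem_bot]
    exact hcon f hf
  obtain ⟨a, ha⟩ : ∃ a, f a ≠ 0 := by
    by_contra! hcon
    exact hf (SteinbergAlgebra.ext hcon)
  obtain ⟨B, hc, hB, haB, -⟩ := exists_isCompact_isOpenBisection isOpen_univ (mem_univ a)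
  have hc' := isCompact_preimage_inv hc
  have ho' : IsOpen (inv ⁻¹' B) := hB.isOpen.preimage continuous_inversion
  set g := char R (inv ⁻¹' B) hc' ho' * f with hg
  have hgI : g ∈ I := I.mul_mem_left _ _ hfI
  have hga : g (s a) = f a := conv_char_inv_apply hc' hB ho' f haB
  have hV : IsOpen (unitSpace G ∩ {b | g b = f a}) :=
    (isOpen_unitSpace G).inter (g.isLocallyConstant.isOpen_fiber _)
  obtain ⟨W, hWV, hWo, ⟨u, hu⟩, hW⟩ := hG.exists_isOpen_forall_eq_zero g _ hV
    ⟨s a, ⟨inv a, r_inv a⟩, hga⟩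
  obtain ⟨K, hKc, hK, huK, hKW⟩ := exists_isCompact_isOpenBisection hWo hu
  have hKu : K ⊆ unitSpace G := fun x hx => (hWV (hKW hx)).1
  refine ⟨f a, K, hKc, hK.isOpen, ha, ⟨u, huK⟩, hKu, ?_⟩
  -- The right side keeps the values of `g` on arrows with both ends in `K`: `f a` at units, `0`
  -- elsewhere by the choice of `W`.
  have e : f a • char R K hKc hK.isOpen =
      char R K hKc hK.isOpen * g * char R K hKc hK.isOpen := by
    ext b
    rw [mul_char_apply hKc hK.isOpen hKu, SteinbergAlgebra.smul_apply]
    by_cases hb : b ∈ K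
    · have hr : r b = b := mem_unitSpace_iff_r.1 (hKu hb)
      have hs : s b = b := s_eq_of_mem_unitSpace (hKu hb)
      rw [indicator_of_mem (by rwa [mem_preimage, hs]), char_mul_apply hKc hK.isOpen hKu,
        indicator_of_mem (by rwa [mem_preimage, hr]), char_of_mem _ _ hb, mul_one]
      exact (hWV (hKW hb)).2.symm
    · rw [char_of_notMem _ _ hb, mul_zero]
      by_cases hs : s b ∈ K
      · rw [indicator_of_mem (by exact hs), char_mul_apply hKc hK.isOpen hKu]
        by_cases hr : r b ∈ K
        · rw [indicator_of_mem (by exact hr)]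
          refine (hW b (fun hbu => hb ?_) (hKW hr) (hKW hs)).symm
          rwa [mem_unitSpace_iff_r.1 hbu] at hr
        · rw [indicator_of_notMem (by exact hr)]
      · rw [indicator_of_notMem (by exact hs)]
  rw [e]
  exact I.mul_mem_right _ _ (I.mul_mem_left _ _ hgI)

/-! ### The open invariant set of an ideal, and the converse. -/

/-- The units that lie in a compact open set of units with characteristic function in `I`. -/
def idealUnits (I : TwoSidedIdeal (SteinbergAlgebra R G)) : Set G :=
  {u | ∃ (K : Set G) (hc : IsCompact K) (ho : IsOpen K),
    u ∈ K ∧ K ⊆ unitSpace G ∧ char R K hc ho ∈ I}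

theorem isOpen_idealUnits (I : TwoSidedIdeal (SteinbergAlgebra R G)) : IsOpen (idealUnits I) :=
  isOpen_iff_mem_nhds.2 fun _ ⟨K, hc, ho, hu, hK, hI⟩ =>
    Filter.mem_of_superset (ho.mem_nhds hu) fun _ hx => ⟨K, hc, ho, hx, hK, hI⟩

/-- If `s(B) ⊆ K` and `1_K ∈ I`, then `1_B = 1_B * 1_K ∈ I`, hence `1_{r(B)} = 1_B * 1_{B⁻¹} ∈ I`.
-/
theorem isInvariant_idealUnits (I : TwoSidedIdeal (SteinbergAlgebra R G)) :
    IsInvariant (idealUnits I) := by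
  refine Subset.antisymm ?_ ?_
  · rintro _ ⟨a, ⟨K, hc, ho, ha, hK, hI⟩, rfl⟩
    obtain ⟨B, hBc, hB, haB, hBK⟩ := exists_isCompact_isOpenBisection
      (ho.preimage (continuous_s G)) ha
    have e : char R B hBc hB.isOpen * char R K hc ho = char R B hBc hB.isOpen := by
      ext b
      rw [mul_char_apply hc ho hK]
      by_cases hb : b ∈ B
      · exact indicator_of_mem (hBK hb) _
      · exact indicator_apply_eq_self.2 fun _ => char_of_notMem _ _ hb
    have hBI : char R B hBc hB.isOpen ∈ I := e ▸ I.mul_mem_left _ _ hI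
    have hc' := isCompact_preimage_inv hBc
    have ho' : IsOpen (inv ⁻¹' B) := hB.isOpen.preimage continuous_inversion
    have hcr : IsCompact (r '' B) := hBc.image (continuous_r G)
    have hor : IsOpen (r '' B) := isOpen_image_r hB hB.isOpen subset_rfl
    refine ⟨r '' B, hcr, hor, mem_image_of_mem r haB, image_subset_range r B, ?_⟩
    rw [← char_mul_char_inv hBc hB hc' ho' hcr hor]
    exact I.mul_mem_right _ _ hBI
  · intro u hu
    obtain ⟨K, hc, ho, huK, hK, hI⟩ := hu
    refine ⟨u, ?_, mem_unitSpace_iff_r.1 (hK huK)⟩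
    rw [mem_preimage, s_eq_of_mem_unitSpace (hK huK)]
    exact ⟨K, hc, ho, huK, hK, hI⟩

/-- A compact set of units covered by sets with characteristic function in `I` lies in one such
set. -/
theorem exists_char_mem_of_isCompact {I : TwoSidedIdeal (SteinbergAlgebra R G)} {S : Set G}
    (hS : IsCompact S) (h : S ⊆ idealUnits I) :
    ∃ (K : Set G) (hc : IsCompact K) (ho : IsOpen K),
      S ⊆ K ∧ K ⊆ unitSpace G ∧ char R K hc ho ∈ I := by
  refine hS.induction_on (p := fun S => ∃ (K : Set G) (hc : IsCompact K) (ho : IsOpen K),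
      S ⊆ K ∧ K ⊆ unitSpace G ∧ char R K hc ho ∈ I) ?_ ?_ ?_ ?_
  · refine ⟨∅, isCompact_empty, isOpen_empty, subset_rfl, empty_subset _, ?_⟩
    rw [char_eq_zero _ _ rfl]
    exact zero_mem _
  · rintro S T hST ⟨K, hc, ho, hTK, hK⟩
    exact ⟨K, hc, ho, hST.trans hTK, hK⟩
  · rintro S T ⟨K, hc, ho, hSK, hK, hI⟩ ⟨L, hc', ho', hTL, hL, hI'⟩
    refine ⟨K ∪ L, hc.union hc', ho.union ho', union_subset_union hSK hTL, union_subset hK hL, ?_⟩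
    -- Inclusion–exclusion, with `1_K * 1_L = 1_{K ∩ L}`.
    have e : char R (K ∪ L) (hc.union hc') (ho.union ho') + char R K hc ho * char R L hc' ho' =
        char R K hc ho + char R L hc' ho' := by
      ext a
      rw [SteinbergAlgebra.add_apply, SteinbergAlgebra.add_apply, char_mul_apply hc ho hK]
      by_cases haK : a ∈ K
      · rw [indicator_of_mem (by rwa [mem_preimage, mem_unitSpace_iff_r.1 (hK haK)]),
          char_of_mem _ _ haK, char_of_mem _ _ (mem_union_left L haK)]
      · by_cases haL : a ∈ L
        · rw [indicator_of_notMem (by rwa [mem_preimage, mem_unitSpace_iff_r.1 (hL haL)]),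
            char_of_notMem _ _ haK, char_of_mem _ _ haL, char_of_mem _ _ (mem_union_right K haL),
            add_comm]
        · have h0 : char R L hc' ho' a = 0 := char_of_notMem _ _ haL
          rw [indicator_apply_eq_zero.2 fun _ => h0, h0, char_of_notMem _ _ haK,
            char_of_notMem _ _ (by simp [haK, haL])]
    rw [eq_sub_of_add_eq e]
    exact sub_mem (add_mem hI hI') (I.mul_mem_right _ _ hI)
  · intro u hu
    obtain ⟨K, hc, ho, huK, hK, hI⟩ := h hu
    exact ⟨K, mem_nhdsWithin_of_mem_nhds (ho.mem_nhds huK), K, hc, ho, subset_rfl, hK, hI⟩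

/-- The range of the support of `f` is compact, so some `1_K ∈ I` is a left unit for `f`. -/
theorem eq_top_of_unitSpace_subset_idealUnits {I : TwoSidedIdeal (SteinbergAlgebra R G)}
    (h : unitSpace G ⊆ idealUnits I) : I = ⊤ := by
  refine eq_top_iff.2 fun f _ => ?_
  obtain ⟨K, hc, ho, hSK, hK, hI⟩ := exists_char_mem_of_isCompact
    (f.hasCompactSupport.isCompact.image (continuous_r G))
    ((image_subset_range r _).trans h)
  have e : char R K hc ho * f = f := by
    ext a
    rw [char_mul_apply hc ho hK]
    refine indicator_apply_eq_self.2 fun ha => ?_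
    by_contra hne
    exact ha (hSK (mem_image_of_mem r (subset_tsupport _ hne)))
  rw [← e]
  exact I.mul_mem_right _ _ hI

theorem IsEffective.isBasicallySimple (hG : IsEffective G) (hm : IsMinimal G) :
    IsBasicallySimple R G := by
  intro I hI
  by_cases hbot : I = ⊥
  · exact Or.inl hbot
  right
  obtain ⟨c, K, hc, ho, hc0, ⟨u, hu⟩, hK, hcI⟩ := hG.exists_smul_char_mem hbot
  -- The only use of basicness: it removes the coefficient `c`.
  have hmem : u ∈ idealUnits I := ⟨K, hc, ho, hu, hK, hI c hc0 K hc ho hK hcI⟩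
  have hsub : idealUnits I ⊆ unitSpace G := fun v ⟨L, _, _, hv, hL, _⟩ => hL hv
  rcases hm _ hsub ((isOpen_idealUnits I).preimage continuous_subtype_val)
    (isInvariant_idealUnits I) with h | h
  · simp [h] at hmem
  · exact eq_top_of_unitSpace_subset_idealUnits h.ge

end Steinberg

theorem theorem4p1 {G : Type*} [TopologicalSpace G] [T2Space G] [Steinberg.AmpleGroupoid G]
    {R : Type*} [CommRing R] [Nontrivial R] :
    Steinberg.IsBasicallySimple R G ↔ Steinberg.IsEffective G ∧ Steinberg.IsMinimal G :=
  ⟨fun h => ⟨h.isEffective, h.isMinimal⟩, fun h => h.1.isBasicallySimple h.2⟩
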